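/- Let $p$ be a prime and $t\ge 1$. A vector $n\in\mathbb Z_p^{t+1}$ is $t$-suitable if $n=(1,n_1,\dots,n_t)$; put $H_n=\{h\in\mathbb Z_p^{t+1}: h\cdot n=0\}$ and let $\mathrm{Id}_n:\mathbb Z_p^{t+1}\to\{0,1\}$ be the characteristic function of $H_n$. The hidden cyclic group of level $t$, $G_{p,t}$, is the group $\mathbb Z_p^{t+1}/H_n$ (cyclic of order $p$), where $n$ is an unknown $t$-suitable vector accessible only through the oracle $\mathrm{Id}_n$, and elements are represented by vectors of $\mathbb Z_p^{t+1}$. A quadruple $(g,h,k,\ell)$ is a DH-quadruple if $g$ is a generator of $G_{p,t}$ and $h=ag$, $k=bg$, $\ell=cg$ in $G_{p,t}$ for some integers $a,b,c$ with $c\equiv ab \pmod p$. For a fixed input $(g,h,k,\ell)\in(\mathbb Z_p^{t+1})^4$, the problem $\mathrm{DDH}(G_{p,t})$ is to decide, given oracle access to $\mathrm{Id}_n$ for a $t$-suitable $n$ for which $g$ is a generator, whether $(g,h,k,\ell)$ is a DH-quadruple. A $k$-query algorithm works on basis states $|x\rangle|a\rangle|z\rangle$ ($x\in\mathbb Z_p^{t+1}$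 a query, $a\in\{0,1\}$, $z$ a finite bit string), starts in $|0\rangle|0\rangle|0\rangle$ and applies $U_0,O_f,U_1,O_f,\dots,O_f,U_k$, where $f$ is the oracle, $O_f|x\rangle|a\rangle|z\rangle=|x\rangle|a+f(x) \bmod 2\rangle|z\rangle$, and the $U_i$ do not depend on $f$ and are unitary in the quantum model, stochastic in the randomized model. It solves the problem for the fixed input if, for every admissible oracle, observing the last bit of $z$ at the end yields the correct answer with probability at least $2/3$. The quantum (randomized) query complexity $Q(\mathrm{DDH}(G_{p,t}))$ (respectively $R(\mathrm{DDH}(G_{p,t}))$) is the maximum over all inputs $(g,h,k,\ell)$ of the smallest $k$ for which there is a $k$-query quantum (randomized) algorithm solving the problem for that input. **Theorem.** $Q(\mathrm{DDH}(G_{p,2}))=\Omega(\sqrt p)$ and $R(\mathrm{DDH}(G_{p,2}))=\Omega(p)$, and the same bounds hold at every level $t\ge 2$. That is, there is an absolute constant $c>0$ such that for all primes $p$ and all $t\ge 2$, $$Q(\mathrm{DDH}(G_{p,t}))\ \ge\ c\sqrt p\qquad\text{and}\qquad R(\mathrm{DDH}(G_{p,t}))\ \ge\ c\,p .$$ -/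

import Mathlib

open scoped Matrix

noncomputable section

/-! ## Query algorithms -/

/-- Basis states `|x⟩|a⟩|z⟩`: query register `x`, answer bit `a`, and a work register `z`
of `w + M` bits, the last `M` of which carry the output. -/
abbrev BasisState (X : Type) (w M : ℕ) : Type := X × Bool × (Fin (w + M) → Bool)

/-- The last `M` bits of the work register. -/
def outputBits {X : Type} {w M : ℕ} (s : BasisState X w M) : Fin M → Bool :=
  fun i => s.2.2 (Fin.natAdd w i)

/-- The query operation, the linear extension of `|x⟩|a⟩|z⟩ ↦ |x⟩|a + f(x) mod 2⟩|z⟩`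
(an involution on basis states, so coordinates are read off by the same map). -/
def queryOp {X R : Type} {w M : ℕ} (f : X → Bool) (v : BasisState X w M → R) :
    BasisState X w M → R :=
  fun s => v (s.1, xor s.2.1 (f s.1), s.2.2)

/-- The initial state `|0⟩|0⟩|0⟩`. -/
def initialState (X R : Type) [Zero X] [DecidableEq X] [Zero R] [One R] (w M : ℕ) :
    BasisState X w M → R :=
  Pi.single (0, false, fun _ => false) 1

/-- The state obtained from `|0⟩|0⟩|0⟩` by applying `U₀, O_f, U₁, O_f, …, O_f, U_k`. -/
def finalState {X R : Type} [Zero X] [Fintype X] [DecidableEq X] [Semiring R] {w M k : ℕ}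
    (U : Fin (k + 1) → Matrix (BasisState X w M) (BasisState X w M) R) (f : X → Bool) :
    BasisState X w M → R :=
  Fin.induction (motive := fun _ => BasisState X w M → R)
    (U 0 *ᵥ initialState X R w M)
    (fun i v => U i.succ *ᵥ queryOp f v)
    (Fin.last k)

/-- A functional oracle problem `A : S → {0,1}^M` with `S ⊆ {0,1}^X`. -/
structure FunctionalOracleProblem (X : Type) (M : ℕ) where
  /-- The set `S` of possible oracles. -/
  dom : Set (X → Bool)
  /-- The answer `A(f)` for `f ∈ S`. -/
  val : dom → (Fin M → Bool)

/-- There is a `k`-query quantum algorithm that computes `A` on every `f ∈ S`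
with probability at least `2/3`. -/
def HasQuantumAlgorithm {X : Type} [Zero X] [Fintype X] [DecidableEq X] {M : ℕ}
    (A : FunctionalOracleProblem X M) (k : ℕ) : Prop :=
  ∃ (w : ℕ) (U : Fin (k + 1) → Matrix (BasisState X w M) (BasisState X w M) ℂ),
    (∀ i, U i ∈ Matrix.unitaryGroup (BasisState X w M) ℂ) ∧
    ∀ f : A.dom,
      (2 / 3 : ℝ) ≤ ∑ s : BasisState X w M with outputBits s = A.val f, ‖finalState U f s‖ ^ 2

/-- There is a `k`-query randomized algorithm that computes `A` on every `f ∈ S`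
with probability at least `2/3`; the non-query operations are stochastic matrices acting on
column vectors, so their entries are nonnegative and their columns sum to `1`. -/
def HasRandomizedAlgorithm {X : Type} [Zero X] [Fintype X] [DecidableEq X] {M : ℕ}
    (A : FunctionalOracleProblem X M) (k : ℕ) : Prop :=
  ∃ (w : ℕ) (U : Fin (k + 1) → Matrix (BasisState X w M) (BasisState X w M) ℝ),
    (∀ i, U i ∈ Matrix.colStochastic ℝ (BasisState X w M)) ∧
    ∀ f : A.dom,
      (2 / 3 : ℝ) ≤ ∑ s : BasisState X w M with outputBits s = A.val f, finalState U f s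

/-- The quantum query complexity: the smallest `k` for which there is a `k`-query quantum
algorithm. -/
def quantumQueryComplexity {X : Type} [Zero X] [Fintype X] [DecidableEq X] {M : ℕ}
    (A : FunctionalOracleProblem X M) : ℕ∞ :=
  ⨅ (k : ℕ) (_ : HasQuantumAlgorithm A k), (k : ℕ∞)

/-- The randomized query complexity: the smallest `k` for which there is a `k`-query randomized
algorithm. -/
def randomizedQueryComplexity {X : Type} [Zero X] [Fintype X] [DecidableEq X] {M : ℕ}
    (A : FunctionalOracleProblem X M) : ℕ∞ :=
  ⨅ (k : ℕ) (_ : HasRandomizedAlgorithm A k), (k : ℕ∞)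

/-! ## Hidden cyclic groups -/

/-- The ambient group `ℤ_p^{t+1}`. -/
abbrev Ambient (p t : ℕ) : Type := Fin (t + 1) → ZMod p

/-- A `t`-suitable vector, `n = (1, n₁, …, n_t)`. -/
def Suitable {p t : ℕ} (n : Ambient p t) : Prop := n 0 = 1

/-- The hyperplane `H_n = {h : h · n = 0}`. -/
def hyperplane {p t : ℕ} (n : Ambient p t) : AddSubgroup (Ambient p t) where
  carrier := {h | h ⬝ᵥ n = 0}
  zero_mem' := zero_dotProduct n
  add_mem' := fun {a b} ha hb => by
    have ha' : a ⬝ᵥ n = 0 := ha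
    have hb' : b ⬝ᵥ n = 0 := hb
    show (a + b) ⬝ᵥ n = 0
    rw [add_dotProduct, ha', hb', add_zero]
  neg_mem' := fun {a} ha => by
    have ha' : a ⬝ᵥ n = 0 := ha
    show (-a) ⬝ᵥ n = 0
    rw [neg_dotProduct, ha', neg_zero]

/-- The identity oracle `Id_n`, with `Id_n(h) = 1` exactly when `h · n = 0`. -/
def identityOracle {p t : ℕ} (n : Ambient p t) : Ambient p t → Bool :=
  fun h => decide (h ⬝ᵥ n = 0)

/-- The hidden cyclic group `G_{p,t} = ℤ_p^{t+1} / H_n`. -/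
abbrev HiddenGroup {p t : ℕ} (n : Ambient p t) : Type := Ambient p t ⧸ hyperplane n

/-- `g` encodes a generator of the hidden cyclic group. -/
def IsGen {p t : ℕ} (n g : Ambient p t) : Prop :=
  ∀ x : HiddenGroup n, x ∈ AddSubgroup.zmultiples (g : HiddenGroup n)

/-- `(g, h, k, l)` encodes a DH-quadruple of the hidden cyclic group. -/
def IsDHQuadruple {p t : ℕ} (n g h k l : Ambient p t) : Prop :=
  IsGen n g ∧ ∃ a b c : ℤ,
    (h : HiddenGroup n) = a • (g : HiddenGroup n) ∧
    (k : HiddenGroup n) = b • (g : HiddenGroup n) ∧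
    (l : HiddenGroup n) = c • (g : HiddenGroup n) ∧
    c ≡ a * b [ZMOD p]

open Classical in
/-- The Boolean functional oracle problem `DDH(G_{p,t})` for a fixed input `(g, h, k, l)`.
The oracles are the `Id_n`, `n` suitable, for which `g` is a generator; the answer says whether
the input is a DH-quadruple. (A suitable `n` is determined by `Id_n`.) -/
def ddhProblem {p t : ℕ} (g h k l : Ambient p t) : FunctionalOracleProblem (Ambient p t) 1 where
  dom := {f | ∃ n, Suitable n ∧ IsGen n g ∧ identityOracle n = f}
  val := fun f _ => decide (∃ n, Suitable n ∧ identityOracle n = f.1 ∧ IsDHQuadruple n g h k l)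

/-- The quantum query complexity of `DDH(G_{p,t})`: the maximum over all inputs. -/
def ddhQuantumComplexity (p t : ℕ) [NeZero p] : ℕ∞ :=
  ⨆ (g : Ambient p t) (h : Ambient p t) (k : Ambient p t) (l : Ambient p t),
    quantumQueryComplexity (ddhProblem g h k l)

/-- The randomized query complexity of `DDH(G_{p,t})`: the maximum over all inputs. -/
def ddhRandomizedComplexity (p t : ℕ) [NeZero p] : ℕ∞ :=
  ⨆ (g : Ambient p t) (h : Ambient p t) (k : Ambient p t) (l : Ambient p t),
    randomizedQueryComplexity (ddhProblem g h k l)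

end

/-!
Fix the input `g = e₀`, `h = k = e₁`, `l = e₂`. The vector `n = (1, x, y, 0, …, 0)` makes it a
DH-quadruple exactly when `y = x ^ 2`, so an algorithm has to tell the points of the parabola
`y = x ^ 2` from those of the shifted parabola `y = x ^ 2 + 1`. A query `u` asks whether
`u₀ + u₁ x + u₂ y = 0`; unless `u₀ = u₁ = u₂ = 0`, this happens for at most two points of either
parabola (`card_parabolaOracle_ne_le_two`). Hence each oracle of the two families is hard to tell
from the single generic oracle, which answers `1` exactly when `u₀ = u₁ = u₂ = 0`.

The hybrid argument turns this into a lower bound, in the quantum and in the randomized model at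
once: states are measured in the `ℓ^q` norm, with `q = 2` for unitary and `q = 1` for stochastic
operations. Run the algorithm with the generic oracle. Replacing it by another oracle moves the
final state by at most the sum, over the queries, of the disturbance of the current state
(`seminorm_finalState_sub_le`), and the `q`-th power of a disturbance is at most `2 ^ q` times the
mass that the state puts on queries where the two oracles differ
(`sum_norm_queryOp_sub_pow_le`). Averaged over one of the families, that mass is at most `2 / p`, so
some member of each family moves the final state, in `q`-th power, by at most `2 (2 k) ^ q / p`
(`exists_seminorm_finalState_sub_pow_le`). The two correct answers being different, both
displacements cannot be small, whence `p = O(k ^ q)` (`card_le_of_distinguishes`).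
-/

noncomputable section

/-! ### The hybrid argument -/

/-- The state right after `U_j`, in a run of the algorithm `U` with the oracle `f`. -/
def stateAt {X R : Type} [Zero X] [Fintype X] [DecidableEq X] [Semiring R] {w M k : ℕ}
    (U : Fin (k + 1) → Matrix (BasisState X w M) (BasisState X w M) R) (f : X → Bool)
    (j : Fin (k + 1)) : BasisState X w M → R :=
  Fin.induction (motive := fun _ => BasisState X w M → R)
    (U 0 *ᵥ initialState X R w M)
    (fun i v => U i.succ *ᵥ queryOp f v) j

/-- The permutation of basis states by which a query to `f` acts. -/
def queryEquiv {X : Type} (w M : ℕ) (f : X → Bool) : BasisState X w M ≃ BasisState X w M where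
  toFun s := (s.1, xor s.2.1 (f s.1), s.2.2)
  invFun s := (s.1, xor s.2.1 (f s.1), s.2.2)
  left_inv s := by simp
  right_inv s := by simp

theorem le_sum_of_succ_le_add : ∀ {k : ℕ} (D : Fin (k + 1) → ℝ) (d : Fin k → ℝ), D 0 ≤ 0 →
    (∀ i : Fin k, D i.succ ≤ D i.castSucc + d i) → D (Fin.last k) ≤ ∑ i, d i
  | 0, D, d, h0, _ => by simpa using h0
  | k + 1, D, d, h0, h => by
    have ih := le_sum_of_succ_le_add (fun i : Fin (k + 1) => D i.castSucc) (fun i => d i.castSucc)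
      h0 (fun i => h i.castSucc)
    have hlast := h (Fin.last k)
    rw [Fin.sum_univ_castSucc]
    rw [Fin.succ_last] at hlast
    linarith

section Hybrid

variable {X 𝕜 : Type} [Fintype X] [RCLike 𝕜] {w M k : ℕ}

theorem sum_norm_queryOp_pow (f : X → Bool) (q : ℕ) (v : BasisState X w M → 𝕜) :
    ∑ s, ‖queryOp f v s‖ ^ q = ∑ s, ‖v s‖ ^ q :=
  Equiv.sum_comp (queryEquiv w M f) (fun s => ‖v s‖ ^ q)

theorem sum_filter_norm_queryOp_pow (P : X → Prop) [DecidablePred P] (f : X → Bool) (q : ℕ)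
    (v : BasisState X w M → 𝕜) :
    ∑ s : BasisState X w M with P s.1, ‖queryOp f v s‖ ^ q =
      ∑ s : BasisState X w M with P s.1, ‖v s‖ ^ q := by
  rw [Finset.sum_filter, Finset.sum_filter]
  exact Equiv.sum_comp (queryEquiv w M f) (fun s => if P s.1 then ‖v s‖ ^ q else 0)

/-- Two oracles act differently on a state only through the mass it puts on the queries where they
differ. -/
theorem sum_norm_queryOp_sub_pow_le (f f₀ : X → Bool) {q : ℕ} (hq : q ≠ 0)
    (v : BasisState X w M → 𝕜) :
    ∑ s, ‖queryOp f v s - queryOp f₀ v s‖ ^ q ≤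
      2 ^ q * ∑ s : BasisState X w M with f s.1 ≠ f₀ s.1, ‖v s‖ ^ q := by
  calc ∑ s, ‖queryOp f v s - queryOp f₀ v s‖ ^ q
      = ∑ s : BasisState X w M with f s.1 ≠ f₀ s.1, ‖queryOp f v s - queryOp f₀ v s‖ ^ q := by
        symm
        apply Finset.sum_filter_of_ne
        intro s _ hs heq
        apply hs
        simp [queryOp, heq, hq]
    _ ≤ ∑ s : BasisState X w M with f s.1 ≠ f₀ s.1,
          2 ^ (q - 1) * (‖queryOp f v s‖ ^ q + ‖queryOp f₀ v s‖ ^ q) := by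
        apply Finset.sum_le_sum
        intro s _
        calc ‖queryOp f v s - queryOp f₀ v s‖ ^ q
            ≤ (‖queryOp f v s‖ + ‖queryOp f₀ v s‖) ^ q := by
              gcongr
              exact norm_sub_le _ _
          _ ≤ _ := add_pow_le (norm_nonneg _) (norm_nonneg _) q
    _ = 2 ^ q * ∑ s : BasisState X w M with f s.1 ≠ f₀ s.1, ‖v s‖ ^ q := by
        rw [← Finset.mul_sum, Finset.sum_add_distrib,
          sum_filter_norm_queryOp_pow (fun x => f x ≠ f₀ x),
          sum_filter_norm_queryOp_pow (fun x => f x ≠ f₀ x)]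
        obtain ⟨r, rfl⟩ := Nat.exists_eq_succ_of_ne_zero hq
        simp only [Nat.succ_eq_add_one, Nat.add_sub_cancel, pow_succ]
        ring

/-- The weight of a set of basis states is stable under small perturbations. The pointwise bound
`hAB` holds for `q = 1` and for `q = 2`; a factor of `‖b‖ ^ q` below `4 / 3` is what the comparison
of two answers of probability `2 / 3` allows. -/
theorem sum_filter_norm_pow_le (N : Seminorm 𝕜 (BasisState X w M → 𝕜)) {q : ℕ}
    (hN : ∀ v, N v ^ q = ∑ s, ‖v s‖ ^ q)
    (hAB : ∀ a b : 𝕜, ‖a‖ ^ q ≤ 7 / 6 * ‖b‖ ^ q + 7 * ‖a - b‖ ^ q)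
    (P : BasisState X w M → Prop) [DecidablePred P] (v v₀ : BasisState X w M → 𝕜) :
    ∑ s with P s, ‖v s‖ ^ q ≤ 7 / 6 * ∑ s with P s, ‖v₀ s‖ ^ q + 7 * N (v - v₀) ^ q := by
  calc ∑ s with P s, ‖v s‖ ^ q
      ≤ ∑ s with P s, (7 / 6 * ‖v₀ s‖ ^ q + 7 * ‖v s - v₀ s‖ ^ q) :=
        Finset.sum_le_sum fun s _ => hAB _ _
    _ = 7 / 6 * ∑ s with P s, ‖v₀ s‖ ^ q + 7 * ∑ s with P s, ‖v s - v₀ s‖ ^ q := by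
        rw [Finset.sum_add_distrib, Finset.mul_sum, Finset.mul_sum]
    _ ≤ _ := by
        rw [hN]
        gcongr
        exact Finset.sum_le_sum_of_subset_of_nonneg (Finset.filter_subset _ _)
          (fun _ _ _ => by positivity)

theorem seminorm_queryOp_le (N : Seminorm 𝕜 (BasisState X w M → 𝕜)) {q : ℕ} (hq : q ≠ 0)
    (hN : ∀ v, N v ^ q = ∑ s, ‖v s‖ ^ q) (f : X → Bool) (v : BasisState X w M → 𝕜) :
    N (queryOp f v) ≤ N v := by
  refine le_of_pow_le_pow_left₀ hq (apply_nonneg N v) ?_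
  rw [hN, hN, sum_norm_queryOp_pow]

variable [Zero X] [DecidableEq X] (N : Seminorm 𝕜 (BasisState X w M → 𝕜))
  (U : Fin (k + 1) → Matrix (BasisState X w M) (BasisState X w M) 𝕜)

theorem seminorm_finalState_sub_le (hU : ∀ i v, N (U i *ᵥ v) ≤ N v) (f f₀ : X → Bool)
    (hf : ∀ v, N (queryOp f v) ≤ N v) :
    N (finalState U f - finalState U f₀) ≤
      ∑ i : Fin k, N (queryOp f (stateAt U f₀ i.castSucc) -
        queryOp f₀ (stateAt U f₀ i.castSucc)) := by
  refine le_sum_of_succ_le_add (fun j => N (stateAt U f j - stateAt U f₀ j)) _ ?_ ?_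
  · simp [stateAt]
  · intro i
    have hs : stateAt U f i.succ - stateAt U f₀ i.succ =
        U i.succ *ᵥ (queryOp f (stateAt U f i.castSucc - stateAt U f₀ i.castSucc) +
          (queryOp f (stateAt U f₀ i.castSucc) - queryOp f₀ (stateAt U f₀ i.castSucc))) := by
      have h1 : queryOp f (stateAt U f i.castSucc - stateAt U f₀ i.castSucc) +
          (queryOp f (stateAt U f₀ i.castSucc) - queryOp f₀ (stateAt U f₀ i.castSucc)) =
          queryOp f (stateAt U f i.castSucc) - queryOp f₀ (stateAt U f₀ i.castSucc) := by
        ext s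
        simp [queryOp]
      rw [h1, Matrix.mulVec_sub]
      rfl
    simp only [hs]
    exact (hU _ _).trans ((map_add_le_add N _ _).trans (by gcongr; exact hf _))

variable {q : ℕ} (hq : q ≠ 0) (hN : ∀ v, N v ^ q = ∑ s, ‖v s‖ ^ q)

include hq hN

theorem sum_norm_stateAt_pow_le_one (hU : ∀ i v, N (U i *ᵥ v) ≤ N v) (f : X → Bool)
    (j : Fin (k + 1)) : ∑ s, ‖stateAt U f j s‖ ^ q ≤ 1 := by
  have h0 : N (initialState X 𝕜 w M) ≤ 1 := by
    refine le_of_pow_le_pow_left₀ hq zero_le_one ?_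
    rw [hN, Finset.sum_eq_single (0, false, fun _ => false)]
    · simp [initialState]
    · intro s _ hs
      simp [initialState, Pi.single_eq_of_ne hs, hq]
    · simp
  have h1 : N (stateAt U f j) ≤ 1 := by
    induction j using Fin.induction with
    | zero => exact (hU _ _).trans h0
    | succ i ih => exact (hU _ _).trans ((seminorm_queryOp_le N hq hN f _).trans ih)
  rw [← hN]
  exact pow_le_one₀ (apply_nonneg N _) h1

/-- If every query separates only few members of a family of oracles from `f₀`, then a run of few
queries on some member ends close to the run on `f₀`. -/
theorem exists_seminorm_finalState_sub_pow_le (hU : ∀ i v, N (U i *ᵥ v) ≤ N v)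
    {ι : Type} [Fintype ι] [Nonempty ι] (f₀ : X → Bool) (f : ι → X → Bool) (m : ℕ)
    (hm : ∀ u, (Finset.univ.filter fun i => f i u ≠ f₀ u).card ≤ m) :
    ∃ i, Fintype.card ι * N (finalState U (f i) - finalState U f₀) ^ q ≤ m * (2 * k) ^ q := by
  -- The disturbance of the `j`-th query under the oracle `f i`.
  set d : ι → Fin k → ℝ := fun i j =>
    N (queryOp (f i) (stateAt U f₀ j.castSucc) - queryOp f₀ (stateAt U f₀ j.castSucc)) with hd
  have hcol : ∀ j, ∑ i, d i j ^ q ≤ 2 ^ q * m := by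
    intro j
    set v := stateAt U f₀ j.castSucc
    calc ∑ i, d i j ^ q
        ≤ ∑ i, 2 ^ q * ∑ s : BasisState X w M with f i s.1 ≠ f₀ s.1, ‖v s‖ ^ q := by
          gcongr with i
          simp only [hd]
          rw [hN]
          exact sum_norm_queryOp_sub_pow_le (f i) f₀ hq v
      _ = 2 ^ q * ∑ s, (Finset.univ.filter fun i => f i s.1 ≠ f₀ s.1).card * ‖v s‖ ^ q := by
          rw [← Finset.mul_sum]
          simp_rw [Finset.sum_filter]
          rw [Finset.sum_comm]
          simp_rw [← Finset.sum_filter, Finset.sum_const, nsmul_eq_mul]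
      _ ≤ 2 ^ q * ∑ s, m * ‖v s‖ ^ q := by
          gcongr with s
          exact_mod_cast hm s.1
      _ ≤ 2 ^ q * m := by
          rw [← Finset.mul_sum]
          have := sum_norm_stateAt_pow_le_one N U hq hN hU f₀ j.castSucc
          gcongr
          exact mul_le_of_le_one_right (Nat.cast_nonneg _) this
  have hrow : ∀ i, N (finalState U (f i) - finalState U f₀) ^ q ≤
      (k : ℝ) ^ (q - 1) * ∑ j, d i j ^ q := by
    intro i
    have h1 := seminorm_finalState_sub_le N U hU (f i) f₀ (seminorm_queryOp_le N hq hN (f i))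
    have h2 : (∑ j, d i j) ^ q ≤ (k : ℝ) ^ (q - 1) * ∑ j, d i j ^ q := by
      obtain ⟨r, rfl⟩ := Nat.exists_eq_succ_of_ne_zero hq
      simpa using pow_sum_le_card_mul_sum_pow (s := Finset.univ) (f := d i)
        (fun j _ => apply_nonneg N _) r
    exact (pow_le_pow_left₀ (apply_nonneg N _) h1 q).trans h2
  have htot : ∑ i, N (finalState U (f i) - finalState U f₀) ^ q ≤ m * (2 * k) ^ q := by
    calc ∑ i, N (finalState U (f i) - finalState U f₀) ^ q
        ≤ ∑ i, (k : ℝ) ^ (q - 1) * ∑ j, d i j ^ q := Finset.sum_le_sum fun i _ => hrow i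
      _ = (k : ℝ) ^ (q - 1) * ∑ j, ∑ i, d i j ^ q := by rw [← Finset.mul_sum, Finset.sum_comm]
      _ ≤ (k : ℝ) ^ (q - 1) * ∑ _j : Fin k, 2 ^ q * (m : ℝ) := by
          gcongr with j
          exact hcol j
      _ = m * (2 * k) ^ q := by
          obtain ⟨r, rfl⟩ := Nat.exists_eq_succ_of_ne_zero hq
          simp [mul_pow, pow_succ]
          ring
  obtain ⟨i, -, hi⟩ := Finset.exists_min_image Finset.univ
    (fun i => N (finalState U (f i) - finalState U f₀) ^ q) Finset.univ_nonempty
  refine ⟨i, le_trans ?_ htot⟩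
  have := Finset.card_nsmul_le_sum Finset.univ
    (fun i => N (finalState U (f i) - finalState U f₀) ^ q) _ (fun j _ => hi j (Finset.mem_univ j))
  simpa using this

/-- An algorithm that gives different answers on two families of oracles, both hard to tell from
`f₀`, needs many queries. -/
theorem card_le_of_distinguishes
    (hAB : ∀ a b : 𝕜, ‖a‖ ^ q ≤ 7 / 6 * ‖b‖ ^ q + 7 * ‖a - b‖ ^ q)
    (hU : ∀ i v, N (U i *ᵥ v) ≤ N v)
    {ι : Type} [Fintype ι] [Nonempty ι] (f₀ : X → Bool) (f f' : ι → X → Bool) (m : ℕ)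
    (hm : ∀ u, (Finset.univ.filter fun i => f i u ≠ f₀ u).card ≤ m)
    (hm' : ∀ u, (Finset.univ.filter fun i => f' i u ≠ f₀ u).card ≤ m)
    {b b' : Fin M → Bool} (hb : b ≠ b')
    (h : ∀ i, (2 / 3 : ℝ) ≤
      ∑ s : BasisState X w M with outputBits s = b, ‖finalState U (f i) s‖ ^ q)
    (h' : ∀ i, (2 / 3 : ℝ) ≤
      ∑ s : BasisState X w M with outputBits s = b', ‖finalState U (f' i) s‖ ^ q) :
    (Fintype.card ι : ℝ) ≤ 84 * m * (2 * k) ^ q := by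
  obtain ⟨i, hi⟩ := exists_seminorm_finalState_sub_pow_le N U hq hN hU f₀ f m hm
  obtain ⟨i', hi'⟩ := exists_seminorm_finalState_sub_pow_le N U hq hN hU f₀ f' m hm'
  have hbnd := (h i).trans (sum_filter_norm_pow_le N hN hAB (fun s => outputBits s = b)
    (finalState U (f i)) (finalState U f₀))
  have hbnd' := (h' i').trans (sum_filter_norm_pow_le N hN hAB (fun s => outputBits s = b')
    (finalState U (f' i')) (finalState U f₀))
  have htotal : ∑ s : BasisState X w M with outputBits s = b, ‖finalState U f₀ s‖ ^ q +
      ∑ s : BasisState X w M with outputBits s = b', ‖finalState U f₀ s‖ ^ q ≤ 1 := by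
    rw [← Finset.sum_union]
    · exact (Finset.sum_le_sum_of_subset_of_nonneg (Finset.subset_univ _)
        (fun _ _ _ => by positivity)).trans
        (sum_norm_stateAt_pow_le_one N U hq hN hU f₀ (Fin.last k))
    · rw [Finset.disjoint_filter]
      rintro s - rfl
      exact hb
  set D := N (finalState U (f i) - finalState U f₀) ^ q
  set D' := N (finalState U (f' i') - finalState U f₀) ^ q
  have hsum : (1 : ℝ) ≤ 42 * (D + D') := by linarith
  have hc : (0 : ℝ) ≤ Fintype.card ι := Nat.cast_nonneg _
  nlinarith [mul_le_mul_of_nonneg_left hsum hc]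

end Hybrid

/-! ### The norms of the two models -/

/-- The `ℓ^r` norm as a seminorm on the plain function type. -/
def lpSeminorm (𝕜 S : Type) [RCLike 𝕜] [Fintype S] (r : ENNReal) [Fact (1 ≤ r)] :
    Seminorm 𝕜 (S → 𝕜) :=
  (normSeminorm 𝕜 (PiLp r fun _ : S => 𝕜)).comp
    (WithLp.linearEquiv r 𝕜 (S → 𝕜)).symm.toLinearMap

theorem lpSeminorm_one_pow {𝕜 S : Type} [RCLike 𝕜] [Fintype S] (v : S → 𝕜) :
    lpSeminorm 𝕜 S 1 v ^ 1 = ∑ s, ‖v s‖ ^ 1 := by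
  simp [lpSeminorm, PiLp.norm_eq_of_L1]

theorem lpSeminorm_two_pow {𝕜 S : Type} [RCLike 𝕜] [Fintype S] (v : S → 𝕜) :
    lpSeminorm 𝕜 S 2 v ^ 2 = ∑ s, ‖v s‖ ^ 2 := by
  simp [lpSeminorm, EuclideanSpace.norm_sq_eq]

theorem lpSeminorm_one_mulVec_le {S : Type} [Fintype S] [DecidableEq S] {A : Matrix S S ℝ}
    (hA : A ∈ Matrix.colStochastic ℝ S) (v : S → ℝ) :
    lpSeminorm ℝ S 1 (A *ᵥ v) ≤ lpSeminorm ℝ S 1 v := by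
  have h1 := lpSeminorm_one_pow (A *ᵥ v)
  have h2 := lpSeminorm_one_pow v
  simp only [pow_one] at h1 h2
  rw [h1, h2]
  calc ∑ s, ‖(A *ᵥ v) s‖ ≤ ∑ s, ∑ r, A s r * ‖v r‖ := by
        gcongr with s
        refine (norm_sum_le _ _).trans (le_of_eq (Finset.sum_congr rfl fun r _ => ?_))
        rw [norm_mul, Real.norm_of_nonneg (Matrix.nonneg_of_mem_colStochastic hA)]
    _ = ∑ r, ‖v r‖ := by
        rw [Finset.sum_comm]
        simp_rw [← Finset.sum_mul, Matrix.sum_col_of_mem_colStochastic hA, one_mul]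

theorem lpSeminorm_two_mulVec_le {S : Type} [Fintype S] [DecidableEq S] {A : Matrix S S ℂ}
    (hA : A ∈ Matrix.unitaryGroup S ℂ) (v : S → ℂ) :
    lpSeminorm ℂ S 2 (A *ᵥ v) ≤ lpSeminorm ℂ S 2 v := by
  have key : ∀ x : S → ℂ, ((∑ s, ‖x s‖ ^ 2 : ℝ) : ℂ) = star x ⬝ᵥ x := by
    intro x
    simp [dotProduct, Complex.conj_mul']
  refine le_of_pow_le_pow_left₀ two_ne_zero (apply_nonneg _ v) (le_of_eq ?_)
  rw [lpSeminorm_two_pow, lpSeminorm_two_pow, ← Complex.ofReal_inj, key, key, Matrix.star_mulVec,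
    Matrix.dotProduct_mulVec, Matrix.vecMul_vecMul, ← Matrix.star_eq_conjTranspose,
    Matrix.mem_unitaryGroup_iff'.mp hA, Matrix.vecMul_one]

/-! ### Two parabolas in the hidden cyclic group -/

theorem hiddenGroup_mk_eq_iff {p t : ℕ} {n a b : Ambient p t} :
    (a : HiddenGroup n) = (b : HiddenGroup n) ↔ a ⬝ᵥ n = b ⬝ᵥ n := by
  rw [QuotientAddGroup.eq]
  change (-a + b) ⬝ᵥ n = 0 ↔ _
  rw [add_dotProduct, neg_dotProduct, neg_add_eq_zero]

theorem hiddenGroup_mk_eq_zsmul_iff {p t : ℕ} {n a b : Ambient p t} {c : ℤ} :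
    (a : HiddenGroup n) = c • (b : HiddenGroup n) ↔ a ⬝ᵥ n = c * (b ⬝ᵥ n) := by
  rw [← QuotientAddGroup.mk_zsmul, hiddenGroup_mk_eq_iff, smul_dotProduct, zsmul_eq_mul]

theorem isGen_of_dotProduct_eq_one {p t : ℕ} {n g : Ambient p t} (hg : g ⬝ᵥ n = 1) :
    IsGen n g := by
  intro x
  induction x using QuotientAddGroup.induction_on with
  | H x =>
    obtain ⟨c, hc⟩ := ZMod.intCast_surjective (x ⬝ᵥ n)
    exact ⟨c, (hiddenGroup_mk_eq_zsmul_iff.mpr (by rw [hg, hc, mul_one])).symm⟩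

theorem isDHQuadruple_iff_of_dotProduct_eq_one {p t : ℕ} {n g h k l : Ambient p t}
    (hg : g ⬝ᵥ n = 1) : IsDHQuadruple n g h k l ↔ l ⬝ᵥ n = (h ⬝ᵥ n) * (k ⬝ᵥ n) := by
  simp only [IsDHQuadruple, hiddenGroup_mk_eq_zsmul_iff, hg, mul_one,
    ← ZMod.intCast_eq_intCast_iff, Int.cast_mul]
  constructor
  · rintro ⟨-, a, b, c, ha, hb, hc, habc⟩
    rw [ha, hb, hc, habc]
  · intro hl
    obtain ⟨a, ha⟩ := ZMod.intCast_surjective (h ⬝ᵥ n)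
    obtain ⟨b, hb⟩ := ZMod.intCast_surjective (k ⬝ᵥ n)
    obtain ⟨c, hc⟩ := ZMod.intCast_surjective (l ⬝ᵥ n)
    exact ⟨isGen_of_dotProduct_eq_one hg, a, b, c, ha.symm, hb.symm, hc.symm,
      by rw [ha, hb, hc, hl]⟩

/-- A suitable vector is determined by its identity oracle, through the queries
`e_j - n_j e₀`. -/
theorem eq_of_identityOracle_eq {p t : ℕ} {n n' : Ambient p t} (hn : Suitable n)
    (hn' : Suitable n') (h : identityOracle n' = identityOracle n) : n' = n := by
  ext j
  have hj := congrFun h (Pi.single j 1 - n j • Pi.single 0 1)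
  have hn0 : n 0 = 1 := hn
  have hn0' : n' 0 = 1 := hn'
  simpa [identityOracle, sub_dotProduct, smul_dotProduct, hn0, hn0', sub_eq_zero] using hj

/-- The suitable vector `(1, x, x ^ 2 + c, 0, …, 0)`. -/
def parabolaPoint {p : ℕ} (t : ℕ) (c x : ZMod p) : Ambient p (t + 2) :=
  Pi.single 0 1 + Pi.single 1 x + Pi.single 2 (x ^ 2 + c)

theorem dotProduct_parabolaPoint {p t : ℕ} (c x : ZMod p) (u : Ambient p (t + 2)) :
    u ⬝ᵥ parabolaPoint t c x = u 0 + u 1 * x + u 2 * (x ^ 2 + c) := by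
  simp [parabolaPoint, dotProduct_add]

theorem parabolaPoint_coordinates {p t : ℕ} (c x : ZMod p) :
    parabolaPoint t c x 0 = 1 ∧ parabolaPoint t c x 1 = x ∧ parabolaPoint t c x 2 = x ^ 2 + c := by
  have h2 : 2 % (t + 2 + 1) = 2 := Nat.mod_eq_of_lt (by omega)
  have h1 : 1 % (t + 2 + 1) = 1 := Nat.mod_eq_of_lt (by omega)
  simp [parabolaPoint, Fin.ext_iff, h1, h2]

theorem suitable_parabolaPoint {p t : ℕ} (c x : ZMod p) : Suitable (parabolaPoint t c x) :=
  (parabolaPoint_coordinates c x).1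

theorem single_dotProduct_parabolaPoint {p t : ℕ} (c x : ZMod p) :
    (Pi.single 0 1 : Ambient p (t + 2)) ⬝ᵥ parabolaPoint t c x = 1 := by
  rw [single_one_dotProduct, (parabolaPoint_coordinates c x).1]

theorem isGen_parabolaPoint {p t : ℕ} (c x : ZMod p) :
    IsGen (parabolaPoint t c x) (Pi.single 0 1) :=
  isGen_of_dotProduct_eq_one (single_dotProduct_parabolaPoint c x)

/-- The oracle that answers `1` to a query exactly when all suitable vectors supported on the first
three coordinates do. -/
def genericOracle (p t : ℕ) (u : Ambient p (t + 2)) : Bool :=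
  decide (u 0 = 0 ∧ u 1 = 0 ∧ u 2 = 0)

theorem card_parabolaOracle_ne_le_two {p : ℕ} [Fact p.Prime] {t : ℕ} (c : ZMod p)
    (u : Ambient p (t + 2)) :
    (Finset.univ.filter fun x => identityOracle (parabolaPoint t c x) u ≠
      genericOracle p t u).card ≤ 2 := by
  by_cases hu : u 0 = 0 ∧ u 1 = 0 ∧ u 2 = 0
  · simp [identityOracle, genericOracle, dotProduct_parabolaPoint, hu]
  · let P : Polynomial (ZMod p) := .C (u 2) * .X ^ 2 + .C (u 1) * .X + .C (u 0 + u 2 * c)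
    have hP : P ≠ 0 := by
      intro hP
      have h0 := congrArg (fun Q => Polynomial.coeff Q 0) hP
      have h1 := congrArg (fun Q => Polynomial.coeff Q 1) hP
      have h2 := congrArg (fun Q => Polynomial.coeff Q 2) hP
      simp [P, Polynomial.coeff_X, Polynomial.coeff_C] at h0 h1 h2
      exact hu ⟨by simpa [h2] using h0, h1, h2⟩
    calc _ ≤ P.roots.toFinset.card := by
          apply Finset.card_le_card
          intro x hx
          simp [identityOracle, genericOracle, dotProduct_parabolaPoint, hu] at hx
          simp only [Multiset.mem_toFinset, Polynomial.mem_roots hP, Polynomial.IsRoot.def, P,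
            Polynomial.eval_add, Polynomial.eval_mul, Polynomial.eval_pow, Polynomial.eval_C,
            Polynomial.eval_X]
          linear_combination hx
      _ ≤ P.natDegree := (Multiset.toFinset_card_le _).trans (Polynomial.card_roots' P)
      _ ≤ 2 := Polynomial.natDegree_quadratic_le

/-- The input for which the lower bounds are proved: `g = e₀`, `h = k = e₁`, `l = e₂`. -/
def parabolaProblem (p t : ℕ) : FunctionalOracleProblem (Ambient p (t + 2)) 1 :=
  ddhProblem (Pi.single 0 1) (Pi.single 1 1) (Pi.single 1 1) (Pi.single 2 1)

/-- The identity oracle of a parabola point, as an admissible oracle. -/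
def parabolaOracle {p : ℕ} (t : ℕ) (c x : ZMod p) : (parabolaProblem p t).dom :=
  ⟨identityOracle (parabolaPoint t c x), parabolaPoint t c x, suitable_parabolaPoint c x,
    isGen_parabolaPoint c x, rfl⟩

theorem parabolaProblem_val {p t : ℕ} (c x : ZMod p) :
    (parabolaProblem p t).val (parabolaOracle t c x) = fun _ => decide (c = 0) := by
  have hdh : IsDHQuadruple (parabolaPoint t c x) (Pi.single 0 1) (Pi.single 1 1) (Pi.single 1 1)
      (Pi.single 2 1) ↔ c = 0 := by
    obtain ⟨-, h1, h2⟩ := parabolaPoint_coordinates (t := t) c x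
    rw [isDHQuadruple_iff_of_dotProduct_eq_one (single_dotProduct_parabolaPoint c x)]
    simp [h1, h2, sq]
  funext _
  simp only [parabolaProblem, ddhProblem, parabolaOracle, decide_eq_decide]
  rw [← hdh]
  constructor
  · rintro ⟨n, hn, hn', h⟩
    rwa [eq_of_identityOracle_eq (suitable_parabolaPoint c x) hn hn'] at h
  · exact fun h => ⟨_, suitable_parabolaPoint c x, rfl, h⟩

/-- An algorithm of either model that tells the two parabolas apart, with states measured in the
matching norm, makes at least of the order of `p ^ (1 / q)` queries. -/
theorem prime_le_of_solves_parabolaProblem {𝕜 : Type} [RCLike 𝕜] {p : ℕ} [Fact p.Prime] {t w k : ℕ}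
    (N : Seminorm 𝕜 (BasisState (Ambient p (t + 2)) w 1 → 𝕜))
    (U : Fin (k + 1) → Matrix (BasisState (Ambient p (t + 2)) w 1)
      (BasisState (Ambient p (t + 2)) w 1) 𝕜)
    {q : ℕ} (hq : q ≠ 0) (hN : ∀ v, N v ^ q = ∑ s, ‖v s‖ ^ q)
    (hAB : ∀ a b : 𝕜, ‖a‖ ^ q ≤ 7 / 6 * ‖b‖ ^ q + 7 * ‖a - b‖ ^ q)
    (hU : ∀ i v, N (U i *ᵥ v) ≤ N v)
    (h : ∀ f : (parabolaProblem p t).dom, (2 / 3 : ℝ) ≤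
      ∑ s : BasisState (Ambient p (t + 2)) w 1 with outputBits s = (parabolaProblem p t).val f,
        ‖finalState U f s‖ ^ q) :
    (p : ℝ) ≤ 168 * (2 * k) ^ q := by
  have key := card_le_of_distinguishes N U hq hN hAB hU (genericOracle p t)
    (fun x : ZMod p => identityOracle (parabolaPoint t 0 x))
    (fun x : ZMod p => identityOracle (parabolaPoint t 1 x)) 2
    (card_parabolaOracle_ne_le_two 0) (card_parabolaOracle_ne_le_two 1)
    (b := fun _ => true) (b' := fun _ => false) (fun e => by simpa using congrFun e 0)
    (fun x => by
      have hx := h (parabolaOracle t 0 x)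
      simp only [parabolaProblem_val, decide_true] at hx
      exact hx)
    (fun x => by
      have hx := h (parabolaOracle t 1 x)
      simp only [parabolaProblem_val, one_ne_zero, decide_false] at hx
      exact hx)
  rw [ZMod.card] at key
  norm_num at key
  exact key

theorem mul_sqrt_le_of_hasQuantumAlgorithm {p : ℕ} [Fact p.Prime] {t k : ℕ}
    (h : HasQuantumAlgorithm (parabolaProblem p t) k) : 1 / 336 * √p ≤ k := by
  obtain ⟨w, U, hU, h⟩ := h
  have key := prime_le_of_solves_parabolaProblem (lpSeminorm ℂ _ 2) U two_ne_zero
    lpSeminorm_two_pow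
    (fun a b => by
      have h1 : ‖a‖ ≤ ‖b‖ + ‖a - b‖ := by
        simpa using norm_add_le b (a - b)
      nlinarith [norm_nonneg a, norm_nonneg b, norm_nonneg (a - b),
        sq_nonneg (‖b‖ - 6 * ‖a - b‖)])
    (fun i v => lpSeminorm_two_mulVec_le (hU i) v) h
  have : √p ≤ 336 * k := Real.sqrt_le_iff.mpr ⟨by positivity, by nlinarith [sq_nonneg (k : ℝ)]⟩
  linarith

theorem mul_le_of_hasRandomizedAlgorithm {p : ℕ} [Fact p.Prime] {t k : ℕ}
    (h : HasRandomizedAlgorithm (parabolaProblem p t) k) : 1 / 336 * (p : ℝ) ≤ k := by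
  obtain ⟨w, U, hU, h⟩ := h
  have key := prime_le_of_solves_parabolaProblem (lpSeminorm ℝ _ 1) U one_ne_zero
    lpSeminorm_one_pow
    (fun a b => by
      have h1 : ‖a‖ ≤ ‖b‖ + ‖a - b‖ := by
        simpa using norm_add_le b (a - b)
      nlinarith [norm_nonneg b, norm_nonneg (a - b)])
    (fun i v => lpSeminorm_one_mulVec_le (hU i) v)
    (fun f => (h f).trans (Finset.sum_le_sum fun s _ => by
      rw [pow_one]
      exact Real.le_norm_self _))
  linarith

theorem ofReal_le_iInf_of_forall_le {P : ℕ → Prop} {x : ℝ} (h : ∀ k, P k → x ≤ k) :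
    ENNReal.ofReal x ≤ ((⨅ (k : ℕ) (_ : P k), (k : ℕ∞) : ℕ∞) : ENNReal) := by
  rcases eq_or_ne (⨅ (k : ℕ) (_ : P k), (k : ℕ∞)) ⊤ with htop | htop
  · simp [htop]
  · have hx : (⌈x⌉₊ : ℕ∞) ≤ ⨅ (k : ℕ) (_ : P k), (k : ℕ∞) :=
      le_iInf₂ fun k hk => by exact_mod_cast Nat.ceil_le.mpr (h k hk)
    calc ENNReal.ofReal x ≤ ENNReal.ofReal (⌈x⌉₊ : ℝ) :=
          ENNReal.ofReal_le_ofReal (Nat.le_ceil x)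
      _ = ((⌈x⌉₊ : ℕ∞) : ENNReal) := by simp
      _ ≤ _ := ENat.toENNReal_le.mpr hx

end

theorem theorem3 :
    ∃ c : ℝ, 0 < c ∧ ∀ (p : ℕ) [Fact p.Prime] (t : ℕ), 2 ≤ t →
      ENNReal.ofReal (c * Real.sqrt p) ≤ (ddhQuantumComplexity p t : ENNReal) ∧
      ENNReal.ofReal (c * p) ≤ (ddhRandomizedComplexity p t : ENNReal) := by
  refine ⟨1 / 336, by norm_num, fun p _ t ht => ?_⟩
  obtain ⟨t, rfl⟩ := Nat.exists_eq_add_of_le' ht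
  constructor
  · refine (ofReal_le_iInf_of_forall_le
      fun k hk => mul_sqrt_le_of_hasQuantumAlgorithm (t := t) hk).trans (ENat.toENNReal_le.mpr ?_)
    exact le_iSup_of_le (Pi.single 0 1) <| le_iSup_of_le (Pi.single 1 1) <|
      le_iSup_of_le (Pi.single 1 1) <| le_iSup_of_le (Pi.single 2 1) le_rfl
  · refine (ofReal_le_iInf_of_forall_le
      fun k hk => mul_le_of_hasRandomizedAlgorithm (t := t) hk).trans (ENat.toENNReal_le.mpr ?_)
    exact le_iSup_of_le (Pi.single 0 1) <| le_iSup_of_le (Pi.single 1 1) <|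
      le_iSup_of_le (Pi.single 1 1) <| le_iSup_of_le (Pi.single 2 1) le_rfl
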